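/- Let $A$ be an alphabet, let $u,v\in A^*$ be words, and let $M=\langle A\mid u=v\rangle$ be the monoid defined by this presentation; write $[w]_M$ for the element of $M$ represented by $w\in A^*$. A non-empty word $r\in A^+$ is said to compress $u=v$ if $u,v\in rA^*\cap A^*r$, and the presentation is compressible if such a word exists. The relation $u=v$ is subspecial if its shorter side is both a prefix and a suffix of its longer side, i.e. $u\in vA^*\cap A^*v$ when $|v|\le |u|$, and $v\in uA^*\cap A^*u$ when $|u|\le |v|$. Suppose that the presentation $\langle A\mid u=v\rangle$ is compressible and that $u=v$ is not subspecial, and let $z$ be the longest word compressing $u=v$. Then the left $\mathbb{Z}M$-module $\mathbb{Z}M[z]_M$ (the principal left ideal of the monoid ring $\mathbb{Z}M$ generated by $[z]_M$) is of type $\mathrm{FP}_\infty$: there is an exact sequence of left $\mathbb{Z}M$-modules $$\cdots\longrightarrow P_2\longrightarrow P_1\longrightarrow P_0\longrightarrow \mathbb{Z}M[z]_M\longrightarrow 0$$ in which every $P_n$ is finitely generated and projective. -/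

import Mathlib

/-- The word `r` seals the word `w`: `w ∈ r A* ∩ A* r`, i.e. `r` is both a prefix and a suffix
of `w` (the two occurrences may overlap). -/
def Seals {A : Type*} (r w : FreeMonoid A) : Prop :=
  (∃ x : FreeMonoid A, w = r * x) ∧ (∃ y : FreeMonoid A, w = y * r)

/-- The word `r` compresses the relation `u = v`: it is non-empty and seals both `u` and `v`. -/
def Compresses {A : Type*} (r u v : FreeMonoid A) : Prop :=
  r ≠ 1 ∧ Seals r u ∧ Seals r v

/-- The presentation `⟨A ∣ u = v⟩` is compressible. -/
def IsCompressible {A : Type*} (u v : FreeMonoid A) : Prop :=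
  ∃ r : FreeMonoid A, Compresses r u v

/-- `z` is the longest word compressing `u = v`. -/
def IsLongestCompressing {A : Type*} (z u v : FreeMonoid A) : Prop :=
  Compresses z u v ∧ ∀ r : FreeMonoid A, Compresses r u v → r.length ≤ z.length

/-- The relation `u = v` is subspecial: its shorter side seals its longer side. If `|v| ≤ |u|`,
this says `u ∈ v A* ∩ A* v`, see `isSubspecial_iff_of_length_le`; the symmetric form spares the
convention `|v| ≤ |u|`. -/
def IsSubspecial {A : Type*} (u v : FreeMonoid A) : Prop :=
  Seals v u ∨ Seals u v

theorem isSubspecial_iff_of_length_le {A : Type*} {u v : FreeMonoid A}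
    (h : v.length ≤ u.length) : IsSubspecial u v ↔ Seals v u := by
  constructor
  · rintro (h1 | ⟨⟨x, hx⟩, -⟩)
    · exact h1
    · have hl : v.length = u.length + x.length := by rw [hx, FreeMonoid.length_mul]
      have hx1 : x = 1 := FreeMonoid.length_eq_zero.mp (by omega)
      have hvu : v = u := by rw [hx, hx1, mul_one]
      subst hvu
      exact ⟨⟨1, (mul_one _).symm⟩, ⟨1, (one_mul _).symm⟩⟩
  · exact Or.inl

/-- The one-relator monoid defined by the presentation `⟨A ∣ u = v⟩`. -/
abbrev OneRelatorMonoid {A : Type*} (u v : FreeMonoid A) : Type _ :=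
  PresentedMonoid (fun a b : FreeMonoid A => a = u ∧ b = v)

/-- The element `[w]_M` of the one-relator monoid `M = ⟨A ∣ u = v⟩` represented by the word `w`. -/
def OneRelatorMonoid.word {A : Type*} (u v w : FreeMonoid A) : OneRelatorMonoid u v :=
  PresentedMonoid.mk (fun a b : FreeMonoid A => a = u ∧ b = v) w

/-- The principal left ideal `ℤM[w]_M` of the monoid ring `ℤM`, where `M = ⟨A ∣ u = v⟩`.
(`Ideal R` is the type of left ideals of `R`.) -/
noncomputable def principalLeftIdeal {A : Type*} (u v w : FreeMonoid A) :
    Ideal (MonoidAlgebra ℤ (OneRelatorMonoid u v)) :=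
  Ideal.span {MonoidAlgebra.of ℤ (OneRelatorMonoid u v) (OneRelatorMonoid.word u v w)}

universe s t

/-- The left `R`-module `V` is of type `FP_∞`: there is a projective resolution
`⋯ ⟶ P 2 ⟶ P 1 ⟶ P 0 ⟶ V ⟶ 0` with every `P n` finitely generated. (A finitely generated
`R`-module always has an isomorphic copy in the universe of `R`.) -/
def IsFPInfty (R : Type s) [Ring R] (V : Type t) [AddCommGroup V] [Module R V] : Prop :=
  ∃ (P : ℕ → ModuleCat.{s} R) (d : ∀ n : ℕ, P (n + 1) →ₗ[R] P n) (ε : P 0 →ₗ[R] V),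
    (∀ n : ℕ, Module.Projective R (P n)) ∧ (∀ n : ℕ, Module.Finite R (P n)) ∧
    Function.Surjective ε ∧ Function.Exact (d 0) ε ∧
    ∀ n : ℕ, Function.Exact (d (n + 1)) (d n)

/-! Write `I` for the left ideal `ℤM[z]`, and `z = z₀b`, `u = z u₀ b`, `v = z v₀ b`, `δ = [u₀] -
[v₀]`. Right multiplication by `[z]` maps `ℤM` onto `I`. It suffices that its kernel is an iterated
extension of finitely many copies of `I`: any such extension is then covered by a finitely generated
projective module whose kernel is again such an extension, and the resolution is built step by step.

The kernel is computed by letting `q` grow along the prefixes of `z`. Passing from `q` to `qc`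
leaves the left annihilator unchanged unless `qc` is also a suffix of `z`. In that case `c = b`, and
the annihilator grows by the annihilator of `[b]`, which is `ℤM[z]δ`. This is a copy of `I` because
right multiplication by `δ` is injective on `I`.

That injectivity is the combinatorial core. A weight on replacements `xuy → xvy` that depends only
on the classes of `xz` and `zy` vanishes on closed derivations, hence is the coboundary of a
potential `Ψ`. With weight `[xz]` for `y` empty and `0` otherwise, `w ↦ -Ψ(wb)` inverts
multiplication by `δ`.

For the vanishing, let `p` be the longest common prefix of `u` and `v`, up to reversal no longer
than their longest common suffix. Then no suffix of `u` or `v` longer than `z` is a prefix of `p`.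
This permits cancelling everything before `z` in derivations, so that two successive replacements at
the front of a word can be eliminated. A closed derivation can thus avoid the first letter, and
induction on the word applies. -/

/-- Weighted derivations for the relation `R true = R false`: `Deriv R F Q n X Y k` says that `X` can
be turned into `Y` by `n` replacements of `x ++ R β ++ y` by `x ++ R (!β) ++ y`, each with a left
context `x` satisfying `Q`, of total weight `k`, where a replacement weighs `± F x y`. -/
inductive Deriv {A G : Type*} [AddCommGroup G] (R : Bool → List A) (F : List A → List A → G)
    (Q : List A → Prop) : ℕ → List A → List A → G → Prop
  | refl (X : List A) : Deriv R F Q 0 X X 0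
  | cons {n : ℕ} {X Y : List A} {k : G} (β : Bool) (x y : List A) (hQ : Q x)
      (hX : X = x ++ R β ++ y) (h : Deriv R F Q n (x ++ R (!β) ++ y) Y k) :
      Deriv R F Q (n + 1) X Y ((if β then F x y else - F x y) + k)

namespace Deriv

variable {A G : Type*} [AddCommGroup G] {R : Bool → List A} {F F' : List A → List A → G}
  {Q Q' : List A → Prop} {n m : ℕ} {X Y Z : List A} {k l : G}

theorem mono (hQ : ∀ x, Q x → Q' x) (h : Deriv R F Q n X Y k) : Deriv R F Q' n X Y k := by
  induction h with
  | refl X => exact refl X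
  | cons β x y hq hX _ ih => exact cons β x y (hQ x hq) hX ih

theorem trans (h : Deriv R F Q n X Y k) (h' : Deriv R F Q m Y Z l) :
    Deriv R F Q (n + m) X Z (k + l) := by
  induction h with
  | refl X => simpa using h'
  | cons β x y hq hX _ ih =>
    have := cons β x y hq hX (ih h')
    rwa [← add_assoc, add_right_comm] at this

theorem symm (h : Deriv R F Q n X Y k) : Deriv R F Q n Y X (-k) := by
  induction h with
  | refl X => simpa using refl X
  | @cons n X Y k β x y hq hX _ ih =>
    have h1 : Deriv R F Q 1 (x ++ R (!β) ++ y) X ((if !β then F x y else - F x y) + 0) :=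
      cons (!β) x y hq rfl (by simpa [hX] using refl X)
    have := ih.trans h1
    convert this using 1
    cases β <;> simp

theorem to_zero {H : Type*} [AddCommGroup H] (h : Deriv R F Q n X Y k) :
    Deriv R (fun _ _ => (0 : H)) (fun _ => True) n X Y 0 := by
  induction h with
  | refl X => exact refl X
  | cons β x y hq hX _ ih => simpa using cons β x y trivial hX ih

theorem append_left (g : List A)
    (h : Deriv R (fun x y => F (g ++ x) y) (fun _ => True) n X Y k) :
    Deriv R F (fun _ => True) n (g ++ X) (g ++ Y) k := by
  induction h with
  | refl X => exact refl _
  | cons β x y hq hX _ ih =>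
    exact cons β (g ++ x) y trivial (by simp [hX]) (by simpa using ih)

theorem reverse (h : Deriv R F (fun _ => True) n X Y k) :
    Deriv (fun β => (R β).reverse) (fun x y => F y.reverse x.reverse) (fun _ => True) n
      X.reverse Y.reverse k := by
  induction h with
  | refl X => exact refl _
  | cons β x y hq hX _ ih =>
    have := cons (R := fun β => (R β).reverse) (F := fun x y => F y.reverse x.reverse)
      (Q := fun _ => True) (X := (x ++ R β ++ y).reverse) β y.reverse x.reverse trivial
      (by simp) (by simpa using ih)
    simpa [hX] using this

theorem eq_of_length_lt (hX : ∀ β, X.length < (R β).length) (h : Deriv R F Q n X Y k) :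
    X = Y ∧ k = 0 := by
  cases h with
  | refl X => exact ⟨rfl, rfl⟩
  | cons β x y hq hX' _ =>
    have := hX β
    simp [hX'] at this
    omega

/-- Derivations that never touch the first letter. -/
theorem tail {c : A} {T : List A} (hX : X = c :: T)
    (h : Deriv R F (fun x => x ≠ []) n X Y k) :
    ∃ T', Y = c :: T' ∧ Deriv R (fun x y => F (c :: x) y) (fun _ => True) n T T' k := by
  induction h generalizing T with
  | refl X => exact ⟨T, hX, refl T⟩
  | cons β x y hq hX' _ ih =>
    obtain ⟨d, x, rfl⟩ := List.exists_cons_of_ne_nil hq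
    rw [hX] at hX'
    simp only [List.cons_append, List.cons.injEq] at hX'
    obtain ⟨rfl, hT⟩ := hX'
    obtain ⟨T', hT', h'⟩ := ih (T := x ++ R (!β) ++ y) (by simp)
    exact ⟨T', hT', cons β x y trivial hT h'⟩

theorem exists_first (h : Deriv R F (fun _ => True) n X Y k) :
    Deriv R F (fun x => x ≠ []) n X Y k ∨
      ∃ (β : Bool) (y : List A) (n₁ n₂ : ℕ) (k₁ k₂ : G),
        Deriv R F (fun x => x ≠ []) n₁ X (R β ++ y) k₁ ∧
        Deriv R F (fun _ => True) n₂ (R (!β) ++ y) Y k₂ ∧ n = n₁ + 1 + n₂ ∧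
        k = k₁ + (if β then F [] y else - F [] y) + k₂ := by
  induction h with
  | refl X => exact Or.inl (refl X)
  | @cons n X Y k β x y hq hX h ih =>
    by_cases hx : x = []
    · subst hx
      refine Or.inr ⟨β, y, 0, n, 0, k, ?_, by simpa using h, by omega, by simp⟩
      simpa [hX] using refl X
    · rcases ih with ih | ⟨γ, y', n₁, n₂, k₁, k₂, h1, h2, hn, hk⟩
      · exact Or.inl (cons β x y hx hX ih)
      · exact Or.inr ⟨γ, y', n₁ + 1, n₂, _, k₂, cons β x y hx hX h1, h2, by omega,
          by rw [hk]; abel⟩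

/-- A weight may be changed where it is not used. -/
theorem congr_of_prefix {z : List A} (hz : ∀ β, z <+: R β)
    (hF : ∀ x y, z <+: x ++ z → F x y = F' x y) (hX : z <+: X)
    (h : Deriv R F (fun _ => True) n X Y k) : Deriv R F' (fun _ => True) n X Y k := by
  induction h with
  | refl X => exact refl X
  | @cons n X Y k β x y hq hX' _ ih =>
    have hpre : ∀ β, x ++ z <+: x ++ R β ++ y := fun β =>
      ((List.prefix_append_right_inj x).2 (hz β)).trans (List.prefix_append _ _)
    -- Both `z` and `xz` are prefixes of the current word, which again begins with `z` after the
    -- replacement.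
    have h1 : z <+: x ++ z :=
      List.prefix_of_prefix_length_le hX (hX' ▸ hpre β) (by simp)
    rw [hF x y h1]
    exact cons β x y trivial hX' (ih (h1.trans (hpre _)))

end Deriv

/-! ### Left reducible pairs: cancellation and closed derivations -/

/-- The words `R true` and `R false` have the common prefix `p`, are followed by different letters
after it, are both sealed by `z`, and have no suffix longer than `z` that is a prefix of `p`. -/
structure IsLeftReducible {A : Type*} (R : Bool → List A) (z p : List A) : Prop where
  exists_letters : ∃ (c : Bool → A) (t : Bool → List A), (∀ β, R β = p ++ c β :: t β) ∧
    c true ≠ c false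
  isPrefix : z <+: p
  isSuffix : ∀ β, z <:+ R β
  length_le : ∀ β q, q <:+ R β → q <+: p → q.length ≤ z.length

/-- The weight `F x y` depends only on the classes of `x ++ z` and of `z ++ y`. -/
structure IsClassWeight {A G : Type*} [AddCommGroup G] (R : Bool → List A) (z : List A)
    (F : List A → List A → G) : Prop where
  left : ∀ {n x x'} (y : List A),
    Deriv R (fun _ _ => (0 : ℤ)) (fun _ => True) n (x ++ z) (x' ++ z) 0 → F x y = F x' y
  right : ∀ {n y y'} (x : List A),
    Deriv R (fun _ _ => (0 : ℤ)) (fun _ => True) n (z ++ y) (z ++ y') 0 → F x y = F x y'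

namespace IsClassWeight

variable {A G : Type*} [AddCommGroup G] {R : Bool → List A} {z : List A} {F : List A → List A → G}

theorem append_left (hF : IsClassWeight R z F) (g : List A) :
    IsClassWeight R z (fun x y => F (g ++ x) y) where
  left y h := hF.left y (by simpa using Deriv.append_left (F := fun _ _ => 0) g h)
  right x h := hF.right _ h

theorem reverse (hF : IsClassWeight R z F) :
    IsClassWeight (fun β => (R β).reverse) z.reverse (fun x y => F y.reverse x.reverse) where
  left y h := hF.right _ (by simpa using h.reverse)
  right x h := hF.left _ (by simpa using h.reverse)

end IsClassWeight

namespace IsLeftReducible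

variable {A G : Type*} [AddCommGroup G] {R : Bool → List A} {z p : List A}

theorem ne_nil (hR : IsLeftReducible R z p) (β : Bool) : R β ≠ [] := by
  obtain ⟨c, t, h, -⟩ := hR.exists_letters
  simp [h]

theorem isPrefix_rel (hR : IsLeftReducible R z p) (β : Bool) : p <+: R β := by
  obtain ⟨c, t, h, -⟩ := hR.exists_letters
  simp [h]

/-- The two sides differ only beyond `p`, so a replacement preceded by at least one letter leaves
the first `p.length + 1` letters alone. These letters tell `R true` from `R false`. -/
theorem take_eq {F : List A → List A → G} {n : ℕ} {X Y : List A} {k : G}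
    (hR : IsLeftReducible R z p) (h : Deriv R F (fun x => x ≠ []) n X Y k) :
    X.take (p.length + 1) = Y.take (p.length + 1) := by
  induction h with
  | refl X => rfl
  | cons β x y hq hX _ ih =>
    obtain ⟨c, t, hRc, -⟩ := hR.exists_letters
    rw [← ih, hX]
    have hx : 0 < x.length := List.length_pos_iff.2 hq
    have key : ∀ β, (x ++ R β ++ y).take (p.length + 1) = (x ++ p).take (p.length + 1) := by
      intro β
      rw [hRc, show x ++ (p ++ c β :: t β) ++ y = (x ++ p) ++ (c β :: t β ++ y) by simp,
        List.take_append_of_le_length (by simp; omega)]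
    rw [key, key]

theorem bool_eq_of_take_eq (hR : IsLeftReducible R z p) {β γ : Bool} {x y : List A}
    (h : (R β ++ x).take (p.length + 1) = (R γ ++ y).take (p.length + 1)) : β = γ := by
  obtain ⟨c, t, hRc, hc⟩ := hR.exists_letters
  simp only [hRc, List.append_assoc, List.cons_append, List.take_length_add_append,
    List.append_cancel_left_eq, List.take_succ_cons, List.take_zero, List.cons.injEq, and_true] at h
  cases β <;> cases γ <;> simp_all

/-- Cancellation of a word `g ++ z` from derivations with at most `n` steps. -/
def CancelsUpTo (G : Type*) [AddCommGroup G] (R : Bool → List A) (z p : List A) (n : ℕ) : Prop :=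
  ∀ (F : List A → List A → G), IsClassWeight R z F → ∀ (g h₁ h₂ : List A) (m : ℕ) (k : G), m ≤ n →
    (∀ q, q <:+ g ++ z → q <+: p → q.length ≤ z.length) →
    Deriv R F (fun _ => True) m (g ++ z ++ h₁) (g ++ z ++ h₂) k →
    ∃ m' ≤ m, Deriv R (fun x y => F (g ++ x) y) (fun _ => True) m' (z ++ h₁) (z ++ h₂) k

/-- Write `R β = gz` and `R (!β) = g'z`. Cancelling `g` leaves a derivation from `zh₁` to `zh₂`,
which can be carried out behind `g'` instead. -/
theorem exchange {F : List A → List A → G} (hR : IsLeftReducible R z p) (hF : IsClassWeight R z F)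
    {n m : ℕ} (hn : CancelsUpTo G R z p n) (hm : m ≤ n) {β : Bool} {h₁ h₂ : List A} {k : G}
    (h : Deriv R F (fun _ => True) m (R β ++ h₁) (R β ++ h₂) k) :
    (∃ m' ≤ m, Deriv R F (fun _ => True) m' (R (!β) ++ h₁) (R (!β) ++ h₂) k) ∧
      F [] h₁ = F [] h₂ := by
  obtain ⟨g, hg⟩ := hR.isSuffix β
  obtain ⟨g', hg'⟩ := hR.isSuffix (!β)
  rw [← hg] at h
  obtain ⟨m', hm', h'⟩ := hn F hF g h₁ h₂ m k hm (hg ▸ hR.length_le β) h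
  refine ⟨⟨m', hm', ?_⟩, hF.right [] h'.to_zero⟩
  rw [← hg', List.append_assoc, List.append_assoc]
  apply Deriv.append_left
  refine h'.congr_of_prefix (fun β => hR.isPrefix.trans (hR.isPrefix_rel β)) ?_
    (List.prefix_append _ _)
  rintro x y ⟨x', hx'⟩
  -- Since `xz = zx'`, the words `gxz = R β x'` and `g'xz = R (!β) x'` differ by one replacement, so
  -- the weights agree.
  refine hF.left y (n := 1) ?_
  have := Deriv.cons (R := R) (F := fun _ _ => (0 : ℤ)) (Q := fun _ => True) β [] x' trivial
    (X := g ++ x ++ z) (by rw [List.append_assoc, ← hx', ← hg]; simp)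
    (Y := g' ++ x ++ z) (n := 0) (k := 0)
    (by rw [← hg', List.append_assoc g', ← hx']; simpa using Deriv.refl _)
  simpa using this

/-- The first two replacements at the front are mutually inverse, as the front is preserved in
between. By `exchange` the part between them can be done without them and their weights cancel; this
saves two steps. -/
theorem exists_untouched {F : List A → List A → G} (hR : IsLeftReducible R z p)
    (hF : IsClassWeight R z F) {N : ℕ} (hN : ∀ n < N, CancelsUpTo G R z p n) :
    ∀ (n : ℕ) {X Y : List A} {k : G}, n ≤ N → Deriv R F (fun _ => True) n X Y k →
      X.take (p.length + 1) = Y.take (p.length + 1) →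
      ∃ m ≤ n, Deriv R F (fun x => x ≠ []) m X Y k := by
  intro n
  induction n using Nat.strong_induction_on with
  | _ n ih =>
    intro X Y k hnN h hXY
    rcases h.exists_first with h | ⟨β, y, n₁, n₂, k₁, k₂, h1, h2, hn, hk⟩
    · exact ⟨n, le_rfl, h⟩
    rcases h2.exists_first with h2 | ⟨γ, y', m₁, m₂, l₁, l₂, h3, h4, hm, hl⟩
    -- A single front replacement would change the first `p.length + 1` letters for good.
    · exfalso
      have := hR.bool_eq_of_take_eq ((hR.take_eq h2).trans (hXY.symm.trans (hR.take_eq h1)))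
      cases β <;> simp at this
    · have hγ := hR.bool_eq_of_take_eq (hR.take_eq h3)
      subst hγ
      obtain ⟨⟨m', hm', h5⟩, hy⟩ := hR.exchange hF (hN m₁ (by omega)) le_rfl
        (h3.mono (fun _ _ => trivial))
      rw [Bool.not_not] at h4 h5
      obtain ⟨m, hmle, h6⟩ := ih (n₁ + m' + m₂) (by omega) (by omega)
        (((h1.mono (fun _ _ => trivial)).trans h5).trans h4) hXY
      refine ⟨m, by omega, ?_⟩
      convert h6 using 1
      rw [hk, hl, hy]
      cases β <;> simp <;> abel

theorem cancelsUpTo (hR : IsLeftReducible R z p) (n : ℕ) : CancelsUpTo G R z p n := by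
  induction n using Nat.strong_induction_on with
  | _ n ih =>
    intro F hF g
    -- Deleting the letter `c` turns the weight into `F (c :: x) y`, so `F` has to vary.
    induction g generalizing F with
    | nil => exact fun h₁ h₂ m k _ _ h => ⟨m, le_rfl, by simpa using h⟩
    | cons c g ihg =>
      intro h₁ h₂ m k hm hq h
      have key : ∃ m' ≤ m, Deriv R F (fun x => x ≠ []) m' (c :: g ++ z ++ h₁)
          (c :: g ++ z ++ h₂) k := by
        by_cases hlen : p.length + 1 ≤ (c :: g ++ z).length
        · refine hR.exists_untouched hF ih m hm h ?_
          rw [List.take_append_of_le_length hlen, List.take_append_of_le_length hlen]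
        -- Here `cgz` is no longer than `p`; a front replacement would make it a prefix of `p`,
        -- although it is longer than `z`.
        · rcases h.exists_first with h | ⟨β, y, n₁, n₂, k₁, k₂, h1, -⟩
          · exact ⟨m, le_rfl, h⟩
          · exfalso
            have h2 : p <+: c :: g ++ z ++ h₁ := by
              have h3 : p <+: (R β ++ y).take (p.length + 1) := by
                rw [List.prefix_take_iff]
                exact ⟨(hR.isPrefix_rel β).trans (List.prefix_append _ _), by omega⟩
              rw [← hR.take_eq h1] at h3
              exact h3.trans (List.take_prefix _ _)
            have h3 : c :: g ++ z <+: p :=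
              List.prefix_of_prefix_length_le (List.prefix_append _ _) h2 (by omega)
            have := hq _ (List.suffix_refl _) h3
            simp at this
      obtain ⟨m', hm', h'⟩ := key
      obtain ⟨T, hT, h''⟩ := h'.tail (by simp only [List.cons_append]; rfl)
      simp only [List.cons_append, List.cons.injEq, true_and] at hT
      subst hT
      obtain ⟨m'', hm'', h3⟩ := ihg (fun x y => F (c :: x) y) (hF.append_left [c]) h₁ h₂ m' k
        (by omega) (fun q hq' => hq q (hq'.trans (List.suffix_cons _ _))) h''
      exact ⟨m'', by omega, by simpa using h3⟩

/-- Closed derivations have weight zero. -/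
theorem closed (hR : IsLeftReducible R z p) (X : List A) :
    ∀ {F : List A → List A → G} {n : ℕ} {k : G}, IsClassWeight R z F →
      Deriv R F (fun _ => True) n X X k → k = 0 := by
  induction X with
  | nil =>
    intro F n k _ h
    exact (Deriv.eq_of_length_lt (X := [])
      (fun β => by simpa using List.length_pos_iff.2 (hR.ne_nil β)) h).2
  | cons c X ih =>
    intro F n k hF h
    obtain ⟨m, -, h'⟩ := hR.exists_untouched hF (fun m _ => hR.cancelsUpTo m) n le_rfl h rfl
    obtain ⟨T, hT, h''⟩ := h'.tail rfl
    simp only [List.cons.injEq, true_and] at hT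
    subst hT
    exact ih (hF.append_left [c]) h''

end IsLeftReducible

/-! ### Longest seals and potentials -/

theorem List.exists_longest_common_prefix {A : Type*} (u v : List A) :
    ∃ p s t : List A, u = p ++ s ∧ v = p ++ t ∧ (∀ q, q <+: u → q <+: v → q <+: p) ∧
      (s = [] ∨ t = [] ∨ ∃ a b s' t', s = a :: s' ∧ t = b :: t' ∧ a ≠ b) := by
  classical
  induction u generalizing v with
  | nil => exact ⟨[], [], v, rfl, rfl, fun q hq _ => hq, Or.inl rfl⟩
  | cons a u ih =>
    cases v with
    | nil => exact ⟨[], a :: u, [], rfl, rfl, fun q _ hq => hq, Or.inr (Or.inl rfl)⟩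
    | cons b v =>
      by_cases hab : a = b
      · subst hab
        obtain ⟨p, s, t, rfl, rfl, hp, h⟩ := ih v
        refine ⟨a :: p, s, t, rfl, rfl, ?_, h⟩
        intro q hq hq'
        cases q with
        | nil => exact List.nil_prefix
        | cons c q =>
          rw [List.cons_prefix_cons] at hq hq' ⊢
          exact ⟨hq.1, hp q hq.2 hq'.2⟩
      · refine ⟨[], a :: u, b :: v, rfl, rfl, ?_, Or.inr (Or.inr ⟨a, b, u, v, rfl, rfl, hab⟩)⟩
        intro q hq hq'
        cases q with
        | nil => exact List.nil_prefix
        | cons c q =>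
          rw [List.cons_prefix_cons] at hq hq'
          exact absurd (hq.1.symm.trans hq'.1) hab

/-- A pair of words given as a function on `Bool`. -/
def boolPair {A : Type*} (u v : List A) : Bool → List A := fun β => if β then u else v

/-- `z` is the longest word sealing both `u` and `v`, and neither of `u` and `v` seals the other. -/
structure IsLongestSeal {A : Type*} (u v z : List A) : Prop where
  pre : z <+: u ∧ z <+: v
  suf : z <:+ u ∧ z <:+ v
  longest : ∀ q, q <+: u → q <+: v → q <:+ u → q <:+ v → q.length ≤ z.length
  not_left : ¬ (u <+: v ∧ u <:+ v)
  not_right : ¬ (v <+: u ∧ v <:+ u)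

namespace IsLongestSeal

variable {A G : Type*} [AddCommGroup G] {u v z : List A}

theorem reverse (h : IsLongestSeal u v z) : IsLongestSeal u.reverse v.reverse z.reverse where
  pre := by simpa using h.suf
  suf := by simpa using h.pre
  longest q h1 h2 h3 h4 := by
    rw [← List.reverse_suffix, List.reverse_reverse] at h1 h2
    rw [← List.reverse_prefix, List.reverse_reverse] at h3 h4
    simpa using h.longest q.reverse h3 h4 h1 h2
  not_left h' := h.not_left (by simpa [and_comm] using h')
  not_right h' := h.not_right (by simpa [and_comm] using h')

/-- Anything no longer than `p` that ends `u` or `v` ends `w`, hence both. So a suffix of one side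
that is a prefix of `p` seals both sides, and `p` itself is neither side, since that side would seal
the other. -/
theorem isLeftReducible (h : IsLongestSeal u v z) {p w s t s' t' : List A}
    (hu : u = p ++ s) (hv : v = p ++ t) (hp : ∀ q, q <+: u → q <+: v → q <+: p)
    (hst : s = [] ∨ t = [] ∨ ∃ a b s' t', s = a :: s' ∧ t = b :: t' ∧ a ≠ b)
    (hu' : u = s' ++ w) (hv' : v = t' ++ w) (hle : p.length ≤ w.length) :
    IsLeftReducible (boolPair u v) z p := by
  have hsuf : ∀ q x : List A, q <:+ x → w <:+ x → q.length ≤ p.length → q <:+ w :=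
    fun q x h1 h2 h3 => List.suffix_of_suffix_length_le h1 h2 (h3.trans hle)
  have hpu : p <+: u := ⟨s, hu.symm⟩
  have hpv : p <+: v := ⟨t, hv.symm⟩
  have hwu : w <:+ u := ⟨s', hu'.symm⟩
  have hwv : w <:+ v := ⟨t', hv'.symm⟩
  refine ⟨?_, hp z h.pre.1 h.pre.2, ?_, ?_⟩
  · rcases hst with rfl | rfl | ⟨a, b, s', t', rfl, rfl, hab⟩
    · exfalso
      rw [List.append_nil] at hu
      subst hu
      exact h.not_left ⟨hpv, (hsuf u u (List.suffix_refl _) hwu le_rfl).trans hwv⟩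
    · exfalso
      rw [List.append_nil] at hv
      subst hv
      exact h.not_right ⟨hpu, (hsuf v v (List.suffix_refl _) hwv le_rfl).trans hwu⟩
    · exact ⟨fun β => if β then a else b, fun β => if β then s' else t',
        fun β => by cases β <;> simp [boolPair, hu, hv], by simpa using hab⟩
  · intro β
    cases β
    exacts [h.suf.2, h.suf.1]
  · intro β q hq hqp
    have : q <:+ w := by
      cases β
      exacts [hsuf q v hq hwv hqp.length_le, hsuf q u hq hwu hqp.length_le]
    exact h.longest q (hqp.trans hpu) (hqp.trans hpv) (this.trans hwu) (this.trans hwv)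

theorem closed (h : IsLongestSeal u v z) {X : List A} {F : List A → List A → G} {n : ℕ} {k : G}
    (hF : IsClassWeight (boolPair u v) z F)
    (hX : Deriv (boolPair u v) F (fun _ => True) n X X k) : k = 0 := by
  obtain ⟨p, s, t, hu, hv, hp, hst⟩ := List.exists_longest_common_prefix u v
  obtain ⟨w, s', t', hu', hv', hw, hst'⟩ := List.exists_longest_common_prefix u.reverse v.reverse
  have hrev : (fun β => (boolPair u v β).reverse) = boolPair u.reverse v.reverse := by
    ext β : 1
    cases β <;> rfl
  rcases le_total p.length w.length with hle | hle
  · refine (h.isLeftReducible hu hv hp hst (s' := s'.reverse) (t' := t'.reverse)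
      (w := w.reverse) ?_ ?_ (by simpa using hle)).closed X hF hX
    · rw [← List.reverse_append, ← hu', List.reverse_reverse]
    · rw [← List.reverse_append, ← hv', List.reverse_reverse]
  · have := h.reverse.isLeftReducible hu' hv' hw hst' (s' := s.reverse) (t' := t.reverse)
      (w := p.reverse) (by simp [hu]) (by simp [hv]) (by simpa using hle)
    rw [← hrev] at this
    exact this.closed X.reverse hF.reverse hX.reverse

/-- A weight depending only on classes is the coboundary of a function on words. -/
theorem exists_potential (h : IsLongestSeal u v z) {F : List A → List A → G}
    (hF : IsClassWeight (boolPair u v) z F) :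
    ∃ Ψ : List A → G, ∀ x y, Ψ (x ++ v ++ y) = Ψ (x ++ u ++ y) + F x y := by
  let S : Setoid (List A) :=
    { r := fun X Y => ∃ n k, Deriv (boolPair u v) F (fun _ => True) n X Y k
      iseqv := ⟨fun X => ⟨0, 0, .refl X⟩, fun ⟨n, k, h⟩ => ⟨n, -k, h.symm⟩,
        fun ⟨n, k, h⟩ ⟨m, l, h'⟩ => ⟨n + m, k + l, h.trans h'⟩⟩ }
  have hout : ∀ X : List A, ∃ n k,
      Deriv (boolPair u v) F (fun _ => True) n (Quotient.mk S X).out X k :=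
    fun X => Quotient.mk_out (s := S) X
  choose n k hk using hout
  -- The potential is the weight of a derivation from a chosen representative of the class.
  refine ⟨k, fun x y => ?_⟩
  have hstep : Deriv (boolPair u v) F (fun _ => True) 1 (x ++ u ++ y) (x ++ v ++ y)
      ((if true then F x y else - F x y) + 0) := .cons true x y trivial rfl (.refl _)
  have heq : Quotient.mk S (x ++ u ++ y) = Quotient.mk S (x ++ v ++ y) :=
    Quotient.sound (s := S) ⟨_, _, hstep⟩
  have h1 := hk (x ++ u ++ y)
  rw [heq] at h1
  have := h.closed hF ((h1.trans hstep).trans (hk (x ++ v ++ y)).symm)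
  simp only [if_true, add_zero] at this
  rw [eq_comm, ← sub_eq_zero, sub_eq_add_neg, this]

end IsLongestSeal

-- Iterated extensions and finiteness

universe u₁

/-- `V` is an iterated extension of `n` copies of `I`. -/
def IsIteratedExtension (R I : Type u₁) [Ring R] [AddCommGroup I] [Module R I] :
    ℕ → ∀ (V : Type u₁) [AddCommGroup V] [Module R V], Prop
  | 0, V, _, _ => Subsingleton V
  | n + 1, V, _, _ => ∃ f : V →ₗ[R] I, Function.Surjective f ∧
      IsIteratedExtension R I n (LinearMap.ker f)

namespace IsIteratedExtension

variable {R I : Type u₁} [Ring R] [AddCommGroup I] [Module R I]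

theorem congr {n : ℕ} : ∀ {V W : Type u₁} [AddCommGroup V] [Module R V] [AddCommGroup W]
    [Module R W], (V ≃ₗ[R] W) → IsIteratedExtension R I n V →
      IsIteratedExtension R I n W := by
  induction n with
  | zero =>
    intro V W _ _ _ _ e h
    have : Subsingleton V := h
    exact e.symm.toEquiv.subsingleton
  | succ n ih =>
    rintro V W _ _ _ _ e ⟨f, hf, h⟩
    refine ⟨f.comp e.symm.toLinearMap, hf.comp e.symm.surjective, ih ?_ h⟩
    refine e.ofSubmodules _ _ ?_
    ext w
    simp [Submodule.mem_map_equiv]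

theorem extension {n m : ℕ} : ∀ {V W : Type u₁} [AddCommGroup V] [Module R V] [AddCommGroup W]
    [Module R W] (f : V →ₗ[R] W), Function.Surjective f →
      IsIteratedExtension R I n W →
      IsIteratedExtension R I m (LinearMap.ker f) →
      IsIteratedExtension R I (m + n) V := by
  induction n with
  | zero =>
    intro V W _ _ _ _ f hf hW hK
    have : Subsingleton W := hW
    have hker : LinearMap.ker f = ⊤ := by
      ext x
      simpa using Subsingleton.elim _ _
    exact congr ((LinearEquiv.ofEq _ _ hker).trans Submodule.topEquiv) hK
  | succ n ih =>
    rintro V W _ _ _ _ f hf ⟨g, hg, hW⟩ hK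
    refine ⟨g.comp f, hg.comp hf, ?_⟩
    let f' : LinearMap.ker (g.comp f) →ₗ[R] LinearMap.ker g :=
      f.restrict (fun x hx => by simpa using hx)
    refine ih f' ?_ hW (congr ?_ hK)
    · rintro ⟨w, hw⟩
      obtain ⟨x, rfl⟩ := hf w
      exact ⟨⟨x, by simpa using hw⟩, rfl⟩
    · refine LinearEquiv.symm (LinearEquiv.ofBijective (LinearMap.codRestrict (LinearMap.ker f)
        ((LinearMap.ker (g.comp f)).subtype.comp (LinearMap.ker f').subtype) ?_) ⟨?_, ?_⟩)
      · rintro ⟨x, hx⟩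
        exact congrArg Subtype.val hx
      · rintro ⟨⟨x, hx⟩, hx'⟩ ⟨⟨y, hy⟩, hy'⟩ hxy
        have : x = y := congrArg Subtype.val hxy
        subst this
        rfl
      · rintro ⟨x, hx⟩
        have hx' : f x = 0 := hx
        exact ⟨⟨⟨x, by simp [hx']⟩, Subtype.ext hx'⟩, rfl⟩

/-- If `I` has a cyclic presentation with kernel an iterated extension of copies of `I`, so has,
up to finitely many generators, every iterated extension of copies of `I`. -/
theorem exists_cover {m : ℕ} (π : R →ₗ[R] I) (hπ : Function.Surjective π)
    (hK : IsIteratedExtension R I m (LinearMap.ker π)) {n : ℕ} :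
    ∀ {V : Type u₁} [AddCommGroup V] [Module R V],
      IsIteratedExtension R I n V →
      ∃ (P : ModuleCat.{u₁} R) (f : P →ₗ[R] V) (l : ℕ), Module.Projective R P ∧
        Module.Finite R P ∧ Function.Surjective f ∧
        IsIteratedExtension R I l (LinearMap.ker f) := by
  induction n with
  | zero =>
    intro V _ _ hV
    have : Subsingleton V := hV
    refine ⟨ModuleCat.of R PUnit, 0, 0, ?_, ?_, fun x => ⟨0, Subsingleton.elim _ _⟩, ?_⟩
    · exact inferInstanceAs (Module.Projective R PUnit.{u₁ + 1})
    · exact inferInstanceAs (Module.Finite R PUnit.{u₁ + 1})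
    · exact inferInstanceAs
        (Subsingleton (LinearMap.ker (0 : (PUnit : Type u₁) →ₗ[R] V)))
  | succ n ih =>
    rintro V _ _ ⟨f, hf, hV⟩
    obtain ⟨P, g, l, hP, hP', hg, hl⟩ := ih hV
    obtain ⟨e, he⟩ := hf (π 1)
    let π' : R →ₗ[R] V := LinearMap.toSpanSingleton R V e
    have hπ' : ∀ r, f (π' r) = π r := by
      intro r
      simp only [π', LinearMap.toSpanSingleton_apply, map_smul, he]
      rw [← map_smul, smul_eq_mul, mul_one]
    -- As in the horseshoe lemma: the kernel of `F` is an extension of `ker π` by `ker g`.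
    let F : P × R →ₗ[R] V := ((LinearMap.ker f).subtype.comp g).coprod π'
    have hF : ∀ x r, F (x, r) = (g x : V) + π' r := fun x r => rfl
    let q : LinearMap.ker F →ₗ[R] LinearMap.ker π :=
      (LinearMap.snd R P R).restrict (by
        rintro ⟨x, r⟩ hx
        have h1 : (g x : V) + π' r = 0 := hx
        have h2 := congrArg f h1
        have h3 : f (g x : V) = 0 := (g x).2
        rw [map_add, h3, zero_add, hπ', map_zero] at h2
        exact h2)
    refine ⟨ModuleCat.of R (P × R), F, l + m,
      inferInstanceAs (Module.Projective R (P × R)), inferInstanceAs (Module.Finite R (P × R)),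
      ?_, extension q ?_ hK (congr ?_ hl)⟩
    · intro x
      obtain ⟨r, hr⟩ := hπ (f x)
      obtain ⟨y, hy⟩ := hg ⟨x - π' r, by simp [hπ', hr]⟩
      exact ⟨(y, r), by rw [hF, hy]; simp⟩
    · rintro ⟨r, hr⟩
      have hr' : π r = 0 := hr
      obtain ⟨y, hy⟩ := hg ⟨- π' r, by simp [hπ', hr']⟩
      exact ⟨⟨(y, r), by rw [LinearMap.mem_ker, hF, hy]; simp⟩, rfl⟩
    · refine LinearEquiv.ofBijective
        (LinearMap.codRestrict (LinearMap.ker q) (LinearMap.codRestrict (LinearMap.ker F)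
          ((LinearMap.inl R P R).comp (LinearMap.ker g).subtype) ?_) ?_) ⟨?_, ?_⟩
      · rintro ⟨x, hx⟩
        have hx' : g x = 0 := hx
        have := hF x 0
        simpa [hx'] using this
      · rintro ⟨x, hx⟩
        exact Subtype.ext rfl
      · rintro ⟨x, hx⟩ ⟨y, hy⟩ hxy
        have : x = y := congrArg (fun a => a.1.1.1) hxy
        exact Subtype.ext this
      · rintro ⟨⟨⟨x, r⟩, h1⟩, h2⟩
        have hr : r = 0 := congrArg Subtype.val h2
        subst hr
        have h3 : (g x : V) + π' 0 = 0 := h1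
        refine ⟨⟨x, ?_⟩, rfl⟩
        rw [map_zero, add_zero] at h3
        exact Subtype.ext h3

/-- A resolution built step by step from covers inside a class of modules. -/
theorem isFPInfty {m : ℕ} (π : R →ₗ[R] I) (hπ : Function.Surjective π)
    (hK : IsIteratedExtension R I m (LinearMap.ker π)) : IsFPInfty R I := by
  let C := {V : ModuleCat.{u₁} R // ∃ n, IsIteratedExtension R I n V}
  have hex : ∀ V : C, ∃ (P : ModuleCat.{u₁} R) (f : P →ₗ[R] V.1) (l : ℕ),
      Module.Projective R P ∧ Module.Finite R P ∧ Function.Surjective f ∧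
        IsIteratedExtension R I l (LinearMap.ker f) :=
    fun V => exists_cover π hπ hK V.2.choose_spec
  choose P f l hP hP' hf hl using hex
  let next : C → C := fun V => ⟨ModuleCat.of R (LinearMap.ker (f V)), l V, hl V⟩
  let V₀ : C := ⟨ModuleCat.of R I, 1, LinearMap.id, Function.surjective_id, by
    change Subsingleton _
    rw [LinearMap.ker_id]
    infer_instance⟩
  let V : ℕ → C := fun n => next^[n] V₀
  have hV : ∀ n, V (n + 1) = next (V n) := fun n => Function.iterate_succ_apply' _ _ _
  have hd : ∀ W W' : C, W' = next W → ∃ d : P W' →ₗ[R] P W, Function.Exact d (f W) ∧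
      ∀ x, d x = 0 ↔ f W' x = 0 := by
    rintro W _ rfl
    refine ⟨(LinearMap.ker (f W)).subtype.comp (f (next W)), ?_, ?_⟩
    · intro y
      constructor
      · intro hy
        obtain ⟨x, hx⟩ := hf (next W) ⟨y, hy⟩
        exact ⟨x, congrArg Subtype.val hx⟩
      · rintro ⟨x, rfl⟩
        exact (f (next W) x).2
    · intro x
      exact ⟨fun h => Subtype.ext h, fun h => congrArg Subtype.val h⟩
  choose d hd1 hd2 using fun n => hd (V n) (V (n + 1)) (hV n)
  refine ⟨fun n => P (V n), d, f (V 0), fun n => hP _, fun n => hP' _, hf _, hd1 0, fun n y => ?_⟩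
  rw [hd2 n, hd1 (n + 1)]

end IsIteratedExtension

/-! ### The integral monoid ring and additive maps out of it -/

namespace OneRelatorMonoid

open FreeMonoid (ofList)

variable {A G : Type*} [AddCommGroup G] (u v : List A)

/-- The integral monoid ring of `⟨A ∣ u = v⟩`, for lists `u` and `v`. -/
abbrev IntRing : Type _ := MonoidAlgebra ℤ (OneRelatorMonoid (ofList u) (ofList v))

/-- The element of the integral monoid ring represented by a list. -/
noncomputable def ringWord (l : List A) : IntRing u v :=
  MonoidAlgebra.of ℤ _ (word (ofList u) (ofList v) (ofList l))

@[simp]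
theorem ringWord_nil : ringWord u v [] = 1 := rfl

@[simp]
theorem ringWord_append (l l' : List A) :
    ringWord u v (l ++ l') = ringWord u v l * ringWord u v l' := by
  simp only [ringWord, ← map_mul]
  rfl

theorem ringWord_left_eq_right : ringWord u v u = ringWord u v v :=
  congrArg (MonoidAlgebra.of ℤ _) (PresentedMonoid.mk_eq_mk_of_rel ⟨rfl, rfl⟩)

variable {u v}

theorem ringWord_eq_of_deriv {F : List A → List A → G} {Q : List A → Prop} {n : ℕ}
    {X Y : List A} {k : G} (h : Deriv (boolPair u v) F Q n X Y k) :
    ringWord u v X = ringWord u v Y := by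
  induction h with
  | refl X => rfl
  | cons β x y hq hX _ ih =>
    rw [← ih, hX]
    cases β <;> simp [boolPair, ringWord_left_eq_right u v]

theorem addHom_ext {S T : IntRing u v →+ G}
    (h : ∀ l, S (ringWord u v l) = T (ringWord u v l)) : S = T := by
  apply MonoidAlgebra.addMonoidHom_ext
  intro m
  obtain ⟨l, rfl⟩ := PresentedMonoid.surjective_mk m
  intro r
  have key : ∀ U : IntRing u v →+ G, U (MonoidAlgebra.single (PresentedMonoid.mk _ l) r) =
      r • U (ringWord u v l.toList) := fun U => by
    rw [← map_zsmul]
    exact congrArg U (by simp [ringWord, word])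
  rw [key, key, h]

/-- A function on words that is invariant under the relation extends to the monoid ring. -/
theorem exists_addHom (f : List A → G) (hf : ∀ x y, f (x ++ u ++ y) = f (x ++ v ++ y)) :
    ∃ T : IntRing u v →+ G, ∀ l, T (ringWord u v l) = f l := by
  -- Quantifying over all contexts makes equality of `f`-values a congruence.
  let c : Con (FreeMonoid A) :=
    { r := fun a b => ∀ x y : List A, f (x ++ a.toList ++ y) = f (x ++ b.toList ++ y)
      iseqv := ⟨fun _ _ _ => rfl, fun h x y => (h x y).symm,
        fun h h' x y => (h x y).trans (h' x y)⟩
      mul' := by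
        intro a b c d h h' x y
        have h1 := h x (c.toList ++ y)
        have h2 := h' (x ++ b.toList) y
        simp only [FreeMonoid.toList_mul, List.append_assoc] at h1 h2 ⊢
        exact h1.trans h2 }
  have hc : conGen (fun a b : FreeMonoid A => a = ofList u ∧ b = ofList v) ≤ c := by
    refine Con.conGen_le.2 ?_
    rintro _ _ ⟨rfl, rfl⟩ x y
    exact hf x y
  let g : OneRelatorMonoid (ofList u) (ofList v) → G :=
    Quotient.lift (fun a : FreeMonoid A => f a.toList) (fun a b hab => by
      simpa using hc hab [] [])
  refine ⟨(Finsupp.liftAddHom fun m => zmultiplesHom G (g m)).comp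
    (MonoidAlgebra.coeffAddEquiv (R := ℤ)
      (M := OneRelatorMonoid (ofList u) (ofList v))).toAddMonoidHom, fun l => ?_⟩
  have : (ringWord u v l).coeff = Finsupp.single (word (ofList u) (ofList v) (ofList l)) 1 := rfl
  change Finsupp.liftAddHom (fun m => zmultiplesHom G (g m)) (ringWord u v l).coeff = f l
  rw [this, Finsupp.liftAddHom_apply_single]
  simp only [zmultiplesHom_apply, one_zsmul]
  rfl

end OneRelatorMonoid

/-! ### Annihilators of words -/

namespace IsLongestSeal

open OneRelatorMonoid

variable {A : Type*} {u v z : List A}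

theorem length_lt_left (h : IsLongestSeal u v z) : z.length < u.length := by
  refine lt_of_le_of_ne h.pre.1.length_le fun hl => ?_
  have := h.pre.1.eq_of_length hl
  subst this
  exact h.not_left ⟨h.pre.2, h.suf.2⟩

theorem swap (h : IsLongestSeal u v z) : IsLongestSeal v u z where
  pre := h.pre.symm
  suf := h.suf.symm
  longest q h1 h2 h3 h4 := h.longest q h2 h1 h4 h3
  not_left := h.not_right
  not_right := h.not_left

theorem exists_eq_append (h : IsLongestSeal u v z) {z₀ : List A} {b : A} (hz : z = z₀ ++ [b]) :
    ∃ u₀, u = z ++ u₀ ++ [b] := by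
  obtain ⟨x, hx⟩ := h.pre.1
  have hx0 : x ≠ [] := by
    rintro rfl
    have := h.length_lt_left
    simp [← hx] at this
  obtain ⟨u₀, c, rfl⟩ := (List.eq_nil_or_concat' x).resolve_left hx0
  have h2 : [b] <:+ z ++ (u₀ ++ [c]) := by
    rw [hx]
    exact (hz ▸ List.suffix_append z₀ [b]).trans h.suf.1
  rw [← List.append_assoc] at h2
  obtain ⟨t, ht⟩ := h2
  have := (List.append_inj' ht rfl).2
  rw [this]
  exact ⟨u₀, by rw [← hx, List.append_assoc]⟩

-- Dependence on `y` through the class of `zy` holds because `z` is shorter than both sides, so no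
-- replacement applies to `z` alone.
open Classical in
theorem isClassWeight (h : IsLongestSeal u v z) :
    IsClassWeight (boolPair u v) z
      (fun x y => if y = [] then ringWord u v (x ++ z) else 0) where
  left y h' := by rw [ringWord_eq_of_deriv h']
  right := by
    have key : ∀ {n : ℕ} {y y' : List A}, Deriv (boolPair u v) (fun _ _ => (0 : ℤ))
        (fun _ => True) n (z ++ y) (z ++ y') 0 → y = [] → y' = [] := by
      rintro n y y' h' rfl
      have := (h'.eq_of_length_lt (fun β => by
        cases β
        exacts [by simpa [boolPair] using h.swap.length_lt_left,
          by simpa [boolPair] using h.length_lt_left])).1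
      simpa using this
    intro n y y' x h'
    have h'' := h'.symm
    rw [neg_zero] at h''
    have : y = [] ↔ y' = [] := ⟨key h', key h''⟩
    simp only [this]

variable {z₀ u₀ v₀ : List A} {b : A}

/-- The map `w ↦ -Ψ(wb)` respects the relation, because the weight is zero when a letter `b`
follows. On `l z u₀` and `l z v₀` its values differ by `Ψ(lv) - Ψ(lu) = [lz]`. -/
theorem exists_leftInverse (h : IsLongestSeal u v z) (hu : u = z ++ u₀ ++ [b])
    (hv : v = z ++ v₀ ++ [b]) :
    ∃ T : IntRing u v →+ IntRing u v, ∀ r,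
      T (r * ringWord u v z * (ringWord u v u₀ - ringWord u v v₀)) = r * ringWord u v z := by
  classical
  obtain ⟨Ψ, hΨ⟩ := h.exists_potential h.isClassWeight
  obtain ⟨T, hT⟩ := exists_addHom (u := u) (v := v) (fun l => - Ψ (l ++ [b])) (by
    intro x y
    have := hΨ x (y ++ [b])
    simp only [List.append_eq_nil_iff, List.cons_ne_self, and_false, if_false, add_zero,
      ← List.append_assoc] at this
    rw [this])
  refine ⟨T, fun r => ?_⟩
  have : T.comp (AddMonoidHom.mulRight
      (ringWord u v z * (ringWord u v u₀ - ringWord u v v₀))) =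
      AddMonoidHom.mulRight (ringWord u v z) := by
    apply addHom_ext
    intro l
    have h1 := hΨ l []
    simp only [if_true, List.append_nil, ringWord_append] at h1
    have h2 : ∀ w, ringWord u v l * (ringWord u v z * ringWord u v w) =
        ringWord u v (l ++ (z ++ w)) := by simp
    simp only [AddMonoidHom.comp_apply, AddMonoidHom.coe_mulRight, mul_sub, map_sub, h2, hT]
    rw [show l ++ (z ++ u₀) ++ [b] = l ++ u by simp [hu],
      show l ++ (z ++ v₀) ++ [b] = l ++ v by simp [hv], h1]
    abel
  simpa [mul_assoc] using DFunLike.congr_fun this r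

/-- Deleting a final `b` is well defined modulo `ℤM[z]δ`: a replacement at the very end changes the
result by a multiple of `[z]δ`. Composed with multiplication by `[b]` it is the quotient map. -/
theorem exists_of_mul_last_eq_zero (hu : u = z ++ u₀ ++ [b]) (hv : v = z ++ v₀ ++ [b])
    {x : IntRing u v} (hx : x * ringWord u v [b] = 0) :
    ∃ r, x = r * ringWord u v z * (ringWord u v u₀ - ringWord u v v₀) := by
  classical
  let N : Submodule (IntRing u v) (IntRing u v) :=
    Ideal.span {ringWord u v z * (ringWord u v u₀ - ringWord u v v₀)}
  obtain ⟨T, hT⟩ := exists_addHom (u := u) (v := v)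
    (fun l => if [b] <:+ l then N.mkQ (ringWord u v l.dropLast) else 0) (by
    intro x y
    rcases List.eq_nil_or_concat' y with rfl | ⟨y, c, rfl⟩
    · have key : ∀ w : List A, (x ++ (z ++ w ++ [b]) ++ []).dropLast = x ++ z ++ w := fun w => by
        rw [show x ++ (z ++ w ++ [b]) ++ [] = (x ++ z ++ w) ++ [b] by simp, List.dropLast_concat]
      have key' : ∀ w : List A, [b] <:+ x ++ (z ++ w ++ [b]) ++ [] := fun w =>
        ⟨x ++ z ++ w, by simp⟩
      have e1 : (x ++ u ++ []).dropLast = x ++ z ++ u₀ := by rw [hu, key]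
      have e2 : (x ++ v ++ []).dropLast = x ++ z ++ v₀ := by rw [hv, key]
      have e3 : [b] <:+ x ++ u ++ [] := by rw [hu]; exact key' u₀
      have e4 : [b] <:+ x ++ v ++ [] := by rw [hv]; exact key' v₀
      rw [if_pos e3, if_pos e4, e1, e2, ← sub_eq_zero, ← map_sub, Submodule.mkQ_apply,
        Submodule.Quotient.mk_eq_zero]
      exact Ideal.mem_span_singleton'.2 ⟨ringWord u v x, by simp [mul_sub]⟩
    · have key : ∀ w : List A, [b] <:+ x ++ w ++ (y ++ [c]) ↔ b = c := by
        intro w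
        constructor
        · rintro ⟨t, ht⟩
          rw [← List.append_assoc] at ht
          simpa using (List.append_inj' ht rfl).2
        · rintro rfl
          exact ⟨x ++ w ++ y, by simp⟩
      have key' : ∀ w : List A, (x ++ w ++ (y ++ [c])).dropLast = x ++ w ++ y := fun w => by
        rw [← List.append_assoc, List.dropLast_concat]
      simp only [key, key', ringWord_append, ringWord_left_eq_right u v])
  have hcomp : T.comp (AddMonoidHom.mulRight (ringWord u v [b])) = N.mkQ.toAddMonoidHom := by
    apply addHom_ext
    intro l
    simp only [AddMonoidHom.comp_apply, AddMonoidHom.coe_mulRight, ← ringWord_append, hT,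
      List.suffix_append, if_true, List.dropLast_concat]
    rfl
  have h1 : T (x * ringWord u v [b]) = N.mkQ x := DFunLike.congr_fun hcomp x
  rw [hx, map_zero, eq_comm, Submodule.mkQ_apply, Submodule.Quotient.mk_eq_zero] at h1
  obtain ⟨r, hr⟩ := Ideal.mem_span_singleton'.1 h1
  exact ⟨r, by rw [← hr, mul_assoc]⟩

/-- The part of `s` reaching left of `y` is no longer than `z`, so it lies in the final `z` common
to `u` and `v`. -/
theorem suffix_of_suffix (h : IsLongestSeal u v z) {s x y : List A} (hs : s <+: z)
    (hsuf : s <:+ x ++ u ++ y) : s <:+ x ++ v ++ y := by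
  by_cases hl : s.length ≤ y.length
  · exact (List.suffix_of_suffix_length_le hsuf (List.suffix_append _ _) hl).trans
      (List.suffix_append _ _)
  · have hys : y <:+ s :=
      List.suffix_of_suffix_length_le (List.suffix_append _ _) hsuf (by omega)
    obtain ⟨s', rfl⟩ := hys
    have hs' : s'.length ≤ z.length := ((List.prefix_append _ _).trans hs).length_le
    have h1 : s' <:+ x ++ u := by
      obtain ⟨t, ht⟩ := hsuf
      rw [← List.append_assoc, List.append_cancel_right_eq] at ht
      exact ⟨t, ht⟩
    have h2 : s' <:+ z := List.suffix_of_suffix_length_le h1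
      (h.suf.1.trans (List.suffix_append _ _)) hs'
    obtain ⟨t, ht⟩ := h2.trans (h.suf.2.trans (List.suffix_append x v))
    exact ⟨t, by rw [← List.append_assoc, ht]⟩

/-- Neither `u` nor `v` can end a word ending in `qc`, so deleting the last letter of such words,
and sending all others to zero, respects the relation. -/
theorem mul_eq_zero_of_not_suffix (h : IsLongestSeal u v z) {q : List A} {c : A}
    (hq : q ++ [c] <+: z) (hqz : ¬ q ++ [c] <:+ z) {x : IntRing u v}
    (hx : x * ringWord u v (q ++ [c]) = 0) : x * ringWord u v q = 0 := by
  classical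
  obtain ⟨T, hT⟩ := exists_addHom (u := u) (v := v)
    (fun l => if q ++ [c] <:+ l then ringWord u v l.dropLast else 0) (by
    intro x y
    rcases List.eq_nil_or_concat' y with rfl | ⟨y, d, rfl⟩
    · have key : ∀ w, z <:+ w → ¬ q ++ [c] <:+ x ++ w ++ [] := fun w hw hw' =>
        hqz (List.suffix_of_suffix_length_le (by simpa using hw')
          (hw.trans (List.suffix_append _ _)) hq.length_le)
      rw [if_neg (key u h.suf.1), if_neg (key v h.suf.2)]
    · have key : q ++ [c] <:+ x ++ u ++ (y ++ [d]) ↔ q ++ [c] <:+ x ++ v ++ (y ++ [d]) :=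
        ⟨fun h' => h.suffix_of_suffix hq h',
          fun h' => h.swap.suffix_of_suffix hq h'⟩
      have key' : ∀ w : List A, (x ++ w ++ (y ++ [d])).dropLast = x ++ w ++ y := fun w => by
        rw [← List.append_assoc, List.dropLast_concat]
      simp only [key, key', ringWord_append, ringWord_left_eq_right u v])
  have hcomp : T.comp (AddMonoidHom.mulRight (ringWord u v (q ++ [c]))) =
      AddMonoidHom.mulRight (ringWord u v q) := by
    apply addHom_ext
    intro l
    simp only [AddMonoidHom.comp_apply, AddMonoidHom.coe_mulRight, ← ringWord_append, hT,
      List.suffix_append, if_true]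
    rw [← List.append_assoc, List.dropLast_concat]
  have h1 : T (x * ringWord u v (q ++ [c])) = x * ringWord u v q := DFunLike.congr_fun hcomp x
  rw [← h1, hx, map_zero]

/-- The left ideal generated by a word. -/
noncomputable abbrev wordIdeal (u v z : List A) : Ideal (IntRing u v) :=
  Ideal.span {ringWord u v z}

/-- Each nonempty prefix of `z` up to `q` that is also a suffix of `z` contributes one copy of the
ideal. -/
theorem isIteratedExtension_ker (h : IsLongestSeal u v z) (hz : z = z₀ ++ [b])
    (q : List A) (hq : q <+: z) :
    ∃ n, IsIteratedExtension (IntRing u v) (wordIdeal u v z) n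
      (LinearMap.ker (LinearMap.toSpanSingleton (IntRing u v) (IntRing u v)
        (ringWord u v q))) := by
  obtain ⟨u₀, hu⟩ := h.exists_eq_append hz
  obtain ⟨v₀, hv⟩ := h.swap.exists_eq_append hz
  set δ := ringWord u v u₀ - ringWord u v v₀ with hδ
  induction q using List.reverseRecOn with
  | nil =>
    refine ⟨0, ?_⟩
    change Subsingleton _
    rw [Submodule.subsingleton_iff_eq_bot, LinearMap.ker_eq_bot']
    intro x hx
    simpa using hx
  | append_singleton q c ih =>
    obtain ⟨n, hn⟩ := ih ((List.prefix_append _ _).trans hq)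
    by_cases hqz : q ++ [c] <:+ z
    · obtain ⟨T, hT⟩ := h.exists_leftInverse hu hv
      let ι : wordIdeal u v z →ₗ[IntRing u v] IntRing u v :=
        (LinearMap.toSpanSingleton (IntRing u v) (IntRing u v) δ).comp
          (wordIdeal u v z).subtype
      have hι : ∀ e : wordIdeal u v z, ι e = (e : IntRing u v) * δ := fun e => rfl
      have hinj : Function.Injective ι := by
        rw [← LinearMap.ker_eq_bot, LinearMap.ker_eq_bot']
        rintro ⟨e, he⟩ h0
        obtain ⟨r, rfl⟩ := Ideal.mem_span_singleton'.1 he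
        rw [hι] at h0
        apply Subtype.ext
        change r * ringWord u v z = 0
        rw [← hT r, ← map_zero T]
        exact congrArg T h0
      have hc : c = b := by
        obtain ⟨t, ht⟩ := hqz
        rw [hz, ← List.append_assoc] at ht
        simpa using (List.append_inj' ht rfl).2
      subst hc
      have hsuf : ∀ w w₀ : List A, z <:+ w → w = z ++ w₀ ++ [c] → ∃ w₁, w₁ ++ q = z ++ w₀ := by
        rintro w w₀ h1 h2
        obtain ⟨t, ht⟩ := hqz.trans h1
        rw [h2, ← List.append_assoc] at ht
        exact ⟨t, (List.append_inj' ht rfl).1⟩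
      obtain ⟨u₁, hu₁⟩ := hsuf u u₀ h.suf.1 hu
      obtain ⟨v₁, hv₁⟩ := hsuf v v₀ h.suf.2 hv
      have hrange : IsIteratedExtension (IntRing u v) (wordIdeal u v z) 1
          (LinearMap.range ι) := by
        refine IsIteratedExtension.congr (LinearEquiv.ofInjective ι hinj)
          ⟨LinearMap.id, Function.surjective_id, ?_⟩
        change Subsingleton _
        rw [LinearMap.ker_id]
        infer_instance
      let V := LinearMap.ker (LinearMap.toSpanSingleton (IntRing u v) (IntRing u v)
        (ringWord u v (q ++ [c])))
      have hVmem : ∀ x, x ∈ V ↔ x * ringWord u v (q ++ [c]) = 0 := fun x => Iff.rfl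
      -- The map `x ↦ x[q]` sends the annihilator of `[qc]` into that of `[c]`, with kernel the
      -- annihilator of `[q]`.
      let f : V →ₗ[IntRing u v] LinearMap.range ι :=
        LinearMap.codRestrict (LinearMap.range ι)
          ((LinearMap.toSpanSingleton (IntRing u v) (IntRing u v) (ringWord u v q)).comp
            V.subtype) (by
          rintro ⟨x, hx⟩
          rw [hVmem, ringWord_append, ← mul_assoc] at hx
          obtain ⟨r, hr⟩ := exists_of_mul_last_eq_zero hu hv hx
          exact ⟨⟨r * ringWord u v z, Ideal.mem_span_singleton'.2 ⟨r, rfl⟩⟩, hr.symm⟩)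
      have hf : ∀ x : V, (f x : IntRing u v) = (x : IntRing u v) * ringWord u v q := fun x => rfl
      refine ⟨n + 1, IsIteratedExtension.extension f ?_ hrange
        (IsIteratedExtension.congr ?_ hn)⟩
      · rintro ⟨_, ⟨e, he⟩, rfl⟩
        obtain ⟨r, rfl⟩ := Ideal.mem_span_singleton'.1 he
        -- Surjectivity of `f`: since `qc` ends both `u` and `v`, the generator `[z]δ` is a left
        -- multiple of `[q]`.
        have e1 : (ringWord u v u₁ - ringWord u v v₁) * ringWord u v q =
            ringWord u v z * δ := by
          rw [sub_mul, ← ringWord_append, ← ringWord_append, hu₁, hv₁, hδ, mul_sub,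
            ringWord_append, ringWord_append]
        have e2 : ringWord u v z * δ * ringWord u v [c] = 0 := by
          rw [hδ, mul_sub, sub_mul, ← ringWord_append, ← ringWord_append, ← ringWord_append,
            ← ringWord_append, ← hu, ← hv, ringWord_left_eq_right, sub_self]
        refine ⟨⟨r * (ringWord u v u₁ - ringWord u v v₁), ?_⟩, ?_⟩
        · rw [hVmem, ringWord_append, mul_assoc, ← mul_assoc _ (ringWord u v q), e1, e2, mul_zero]
        · apply Subtype.ext
          rw [hf]
          change r * _ * _ = r * ringWord u v z * δ
          rw [mul_assoc, e1, mul_assoc]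
      · refine LinearEquiv.ofBijective (LinearMap.codRestrict (LinearMap.ker f)
          (LinearMap.codRestrict V (Submodule.subtype _) ?_) ?_) ⟨?_, ?_⟩
        · rintro ⟨x, hx⟩
          have hx' : x * ringWord u v q = 0 := hx
          rw [hVmem, ringWord_append, ← mul_assoc]
          change x * _ * _ = 0
          rw [hx', zero_mul]
        · rintro ⟨x, hx⟩
          exact Subtype.ext hx
        · rintro ⟨x, hx⟩ ⟨y, hy⟩ hxy
          have : x = y := congrArg (fun a => a.1.1) hxy
          exact Subtype.ext this
        · rintro ⟨⟨x, hx⟩, hx'⟩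
          exact ⟨⟨x, congrArg Subtype.val hx'⟩, rfl⟩
    · refine ⟨n, IsIteratedExtension.congr (LinearEquiv.ofEq _ _ ?_) hn⟩
      ext x
      change x * ringWord u v q = 0 ↔ x * ringWord u v (q ++ [c]) = 0
      refine ⟨fun hx => ?_, fun hx => h.mul_eq_zero_of_not_suffix hq hqz hx⟩
      rw [ringWord_append, ← mul_assoc, hx, zero_mul]

theorem isFPInfty_wordIdeal (h : IsLongestSeal u v z) (hz : z ≠ []) :
    IsFPInfty (IntRing u v) (wordIdeal u v z) := by
  obtain ⟨z₀, b, hzb⟩ := (List.eq_nil_or_concat' z).resolve_left hz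
  obtain ⟨n, hn⟩ := h.isIteratedExtension_ker hzb z (List.prefix_refl z)
  let π : IntRing u v →ₗ[IntRing u v] wordIdeal u v z :=
    LinearMap.codRestrict (wordIdeal u v z)
      (LinearMap.toSpanSingleton (IntRing u v) (IntRing u v) (ringWord u v z))
      (fun r => Ideal.mem_span_singleton'.2 ⟨r, rfl⟩)
  refine IsIteratedExtension.isFPInfty (m := n) π ?_
    (IsIteratedExtension.congr (LinearEquiv.ofEq _ _ (LinearMap.ker_codRestrict _ _ _).symm) hn)
  rintro ⟨x, hx⟩
  obtain ⟨r, rfl⟩ := Ideal.mem_span_singleton'.1 hx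
  exact ⟨r, rfl⟩

end IsLongestSeal

/-! ### From words of the free monoid to lists -/

theorem seals_iff {A : Type*} {r w : FreeMonoid A} :
    Seals r w ↔ r.toList <+: w.toList ∧ r.toList <:+ w.toList := by
  constructor
  · rintro ⟨⟨x, rfl⟩, ⟨y, hy⟩⟩
    refine ⟨⟨x.toList, rfl⟩, ⟨y.toList, ?_⟩⟩
    rw [hy]
    rfl
  · rintro ⟨⟨x, hx⟩, ⟨y, hy⟩⟩
    exact ⟨⟨FreeMonoid.ofList x, hx.symm⟩, ⟨FreeMonoid.ofList y, hy.symm⟩⟩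

theorem isLongestSeal_of_isLongestCompressing {A : Type*} {u v z : FreeMonoid A}
    (hsub : ¬ IsSubspecial u v) (hz : IsLongestCompressing z u v) :
    IsLongestSeal u.toList v.toList z.toList where
  pre := ⟨(seals_iff.1 hz.1.2.1).1, (seals_iff.1 hz.1.2.2).1⟩
  suf := ⟨(seals_iff.1 hz.1.2.1).2, (seals_iff.1 hz.1.2.2).2⟩
  longest q h1 h2 h3 h4 := by
    rcases eq_or_ne q [] with rfl | hq
    · simp
    · exact hz.2 (FreeMonoid.ofList q) ⟨hq, seals_iff.2 ⟨h1, h3⟩, seals_iff.2 ⟨h2, h4⟩⟩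
  not_left h := hsub (Or.inr (seals_iff.2 h))
  not_right h := hsub (Or.inl (seals_iff.2 h))

theorem mainTheorem6 {A : Type*} (u v z : FreeMonoid A)
    (hcomp : IsCompressible u v) (hsub : ¬ IsSubspecial u v)
    (hz : IsLongestCompressing z u v) :
    IsFPInfty (MonoidAlgebra ℤ (OneRelatorMonoid u v)) (principalLeftIdeal u v z) :=
  (isLongestSeal_of_isLongestCompressing hsub hz).isFPInfty_wordIdeal
    (fun h => hz.1.1 (FreeMonoid.toList.injective h))
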